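/- Let $F$ be a field with $\operatorname{char} F\neq 2,3$, and let $M_n$ be the Lie algebra of $n\times n$ matrices over $F$ with $[X,Y]=XY-YX$. Let $L=\{(i_1,j_1),\dots,(i_s,j_s)\}\subseteq\{1,\dots,n\}^2$ be a strongly dominant upper triangular (SDUT) ladder, i.e. $s\ge 0$, $i_1<\dots<i_s$, $j_1<\dots<j_s$, $j_\ell<i_\ell$ for $1\le\ell\le s$, and $i_\ell<j_{\ell+1}$ for $1\le\ell\le s-1$. Let $M_L\subseteq M_n$ be the Lie algebra of all matrices $A$ with $A_{pq}=0$ unless $p\le i_\ell$ and $q\ge j_\ell$ for some $\ell$. Partition $\{1,\dots,n\}$ into consecutive blocks by cutting right after each element of $\gamma_L=(\{i_1,\dots,i_s\}\cup\{j_1-1,\dots,j_s-1\})\setminus\{0,n\}$; call a matrix block upper triangular if it is so with respect to this partition. Let $M_L^0$ be the Lie algebra of all $A\in M_L$ that have trace zero on every diagonal block. Let $N(M_L)=\{X\in M_n:[X,M_L]\subseteq M_L\}$ and $C(M_L)=\{X\in M_n:[X,M_L]=0\}$ be the normalizer and the centralizer of $M_L$ in $M_n$. Then: 1. $M_L^0=[M_L,M_L]$.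 2. Every derivation $f$ of $M_L^0$ extends to a derivation $f^+$ of $M_L$, i.e. $f^+|_{M_L^0}=f$. 3. For every derivation $f$ of $M_L^0$ there is a block upper triangular matrix $X\in M_n$ with $f(B)=[X,B]$ for all $B\in M_L^0$. 4. $\operatorname{Der}(M_L^0)=\operatorname{ad}\bigl(N(M_L)/C(M_L)\bigr)|_{M_L^0}$: the assignment $X+C(M_L)\mapsto(\operatorname{ad}X)|_{M_L^0}$ is a well-defined isomorphism of Lie algebras $N(M_L)/C(M_L)\to\operatorname{Der}(M_L^0)$. -/

import Mathlib

/- The Lie bracket on square matrices is the commutator `⁅X, Y⁆ = X * Y - Y * X`. -/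
attribute [local instance 100] LieRing.ofAssociativeRing

section Centralizer

variable {F : Type*} [CommRing F] {G : Type*} [LieRing G] [LieAlgebra F G]

/-- The centralizer of a Lie subalgebra `H` in the ambient Lie algebra `G`. -/
def lieCentralizer (H : LieSubalgebra F G) : LieSubalgebra F G where
  carrier := {A | ∀ B ∈ H, ⁅A, B⁆ = 0}
  zero_mem' := fun B _ => zero_lie B
  add_mem' := fun {X Y} hX hY B hB => by rw [add_lie, hX B hB, hY B hB, add_zero]
  smul_mem' := fun c X hX B hB => by rw [smul_lie, hX B hB, smul_zero]
  lie_mem' := fun {X Y} hX hY B hB => by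
    rw [lie_lie, hX B hB, hY B hB, lie_zero, lie_zero, sub_zero]

theorem lieCentralizer_le_normalizer (H : LieSubalgebra F G) :
    lieCentralizer H ≤ H.normalizer := fun X hX => by
  rw [LieSubalgebra.mem_normalizer_iff]
  intro B hB
  have h : ⁅X, B⁆ = 0 := hX B hB
  rw [h]
  exact H.zero_mem

/-- The centralizer of `H`, which is contained in the normalizer of `H`, viewed as an ideal of the
normalizer. -/
def centralizerIdeal (H : LieSubalgebra F G) : LieIdeal F H.normalizer where
  carrier := {X | (X : G) ∈ lieCentralizer H}
  zero_mem' := (lieCentralizer H).zero_mem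
  add_mem' := fun hX hY => (lieCentralizer H).add_mem hX hY
  smul_mem' := fun c _ hX => (lieCentralizer H).smul_mem c hX
  lie_mem := fun {X Y} hY B hB => by
    have hXB : ⁅(X : G), B⁆ ∈ H := (H.mem_normalizer_iff (X : G)).1 X.2 B hB
    have h1 : ⁅(Y : G), B⁆ = 0 := hY B hB
    have h2 : ⁅(Y : G), ⁅(X : G), B⁆⁆ = 0 := hY _ hXB
    rw [LieSubalgebra.coe_bracket, lie_lie, h1, h2, lie_zero, sub_zero]

end Centralizer

/-- A ladder of size `n` and step `s`: corner points `(row 0, col 0), …, (row (s-1), col (s-1))`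
in the index set of `n × n` matrices, with strictly increasing rows and columns. Rows and columns
are numbered from `0` to `n - 1`. The empty ladder (`step = 0`) is allowed. -/
structure Ladder (n : ℕ) where
  step : ℕ
  row : Fin step → Fin n
  col : Fin step → Fin n
  row_strictMono : StrictMono row
  col_strictMono : StrictMono col

namespace Ladder

variable {n : ℕ}

/-- `I(L)`: the positions `(p, q)` dominated by some corner point `(i, j)`, i.e. `p ≤ i`, `j ≤ q`. -/
def support (L : Ladder n) : Set (Fin n × Fin n) :=
  {x | ∃ l, x.1 ≤ L.row l ∧ L.col l ≤ x.2}

/-- Upper triangular ladders: the row of each corner point is smaller than the column of the next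
one. -/
def IsUpperTriangular (L : Ladder n) : Prop :=
  ∀ l m : Fin L.step, (l : ℕ) + 1 = m → L.row l < L.col m

/-- Strongly dominant upper triangular (SDUT) ladders. -/
structure IsSDUT (L : Ladder n) : Prop where
  isUpperTriangular : L.IsUpperTriangular
  col_lt_row : ∀ l, L.col l < L.row l

/-- The partition of a ladder: the set of all `c` with `0 < c < n` such that matrices are cut right
after the first `c` rows and columns. With rows and columns numbered from `0`, a corner point
`(i, j)` gives the cuts `i + 1` and `j`. -/
def cuts (L : Ladder n) : Finset ℕ :=
  (Finset.univ.image (fun l => (L.row l : ℕ) + 1) ∪ Finset.univ.image (fun l => (L.col l : ℕ))) \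
    {0, n}

/-- The block (numbered from `0` to `L.cuts.card`) to which an index belongs: the number of cuts
that lie before it. -/
def block (L : Ladder n) (p : Fin n) : ℕ :=
  (L.cuts.filter (fun c => c ≤ (p : ℕ))).card

theorem IsUpperTriangular.row_lt_col {L : Ladder n} (hL : L.IsUpperTriangular)
    {l m : Fin L.step} (h : l < m) : L.row l < L.col m := by
  have h1 : (l : ℕ) + 1 < L.step := lt_of_le_of_lt (Nat.succ_le_of_lt h) m.2
  exact (hL l ⟨l + 1, h1⟩ rfl).trans_le
    (L.col_strictMono.monotone (Fin.le_def.2 (Nat.succ_le_of_lt h)))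

theorem IsUpperTriangular.mem_support_trans {L : Ladder n} (hL : L.IsUpperTriangular)
    {p q r : Fin n} (h1 : (p, q) ∈ L.support) (h2 : (q, r) ∈ L.support) : (p, r) ∈ L.support := by
  obtain ⟨l, hl1, hl2⟩ := h1
  obtain ⟨m, hm1, hm2⟩ := h2
  rcases le_or_gt l m with h | h
  · exact ⟨m, hl1.trans (L.row_strictMono.monotone h), hm2⟩
  · exact absurd (hl2.trans hm1) (not_le.2 (hL.row_lt_col h))

theorem IsUpperTriangular.block_le {L : Ladder n} (hL : L.IsUpperTriangular)
    {p q : Fin n} (h : (p, q) ∈ L.support) : L.block p ≤ L.block q := by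
  obtain ⟨l, hl1, hl2⟩ := h
  apply Finset.card_le_card
  intro c hc
  rw [Finset.mem_filter] at hc ⊢
  refine ⟨hc.1, ?_⟩
  by_contra hcq
  simp only [cuts, Finset.mem_sdiff, Finset.mem_union, Finset.mem_image, Finset.mem_univ,
    true_and] at hc
  simp only [Fin.le_def] at hl1 hl2
  obtain ⟨⟨⟨m, hm⟩ | ⟨m, hm⟩, -⟩, hcp⟩ := hc
  · rcases lt_or_ge m l with hml | hml
    · have := Fin.lt_def.1 (hL.row_lt_col hml)
      omega
    · have := Fin.le_def.1 (L.row_strictMono.monotone hml)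
      omega
  · rcases lt_or_ge l m with hml | hml
    · have := Fin.lt_def.1 (hL.row_lt_col hml)
      omega
    · have := Fin.le_def.1 (L.col_strictMono.monotone hml)
      omega

variable (F : Type*) [Field F]

/-- The Lie algebra `M_L` of all `n × n` matrices whose entries outside of `I(L)` are zero, for an
upper triangular ladder `L`. -/
def lieAlg (L : Ladder n) (hL : L.IsUpperTriangular) :
    LieSubalgebra F (Matrix (Fin n) (Fin n) F) where
  carrier := {A | ∀ p q, (p, q) ∉ L.support → A p q = 0}
  zero_mem' := fun _ _ _ => rfl
  add_mem' := fun {A B} hA hB p q h => by rw [Matrix.add_apply, hA p q h, hB p q h, add_zero]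
  smul_mem' := fun c A hA p q h => by rw [Matrix.smul_apply, hA p q h, smul_zero]
  lie_mem' := fun {A B} hA hB p q h => by
    have key : ∀ X Y : Matrix (Fin n) (Fin n) F,
        (∀ p q, (p, q) ∉ L.support → X p q = 0) → (∀ p q, (p, q) ∉ L.support → Y p q = 0) →
        (X * Y) p q = 0 := by
      intro X Y hX hY
      rw [Matrix.mul_apply]
      refine Finset.sum_eq_zero fun k _ => ?_
      by_cases h1 : (p, k) ∈ L.support
      · rw [hY k q (fun h2 => h (hL.mem_support_trans h1 h2)), mul_zero]
      · rw [hX p k h1, zero_mul]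
    rw [Ring.lie_def, Matrix.sub_apply, key A B hA hB, key B A hB hA, sub_zero]

/-- The trace of the `k`-th diagonal block of `A` with respect to the partition of `L`. -/
def blockTrace {F : Type*} [Field F] (L : Ladder n) (k : ℕ) (A : Matrix (Fin n) (Fin n) F) : F :=
  ∑ p with L.block p = k, A p p

theorem IsUpperTriangular.blockTrace_lie {F : Type*} [Field F] {L : Ladder n}
    (hL : L.IsUpperTriangular) (k : ℕ) {A B : Matrix (Fin n) (Fin n) F}
    (hA : A ∈ L.lieAlg F hL) (hB : B ∈ L.lieAlg F hL) : L.blockTrace k ⁅A, B⁆ = 0 := by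
  have key : ∀ X Y : Matrix (Fin n) (Fin n) F, X ∈ L.lieAlg F hL → Y ∈ L.lieAlg F hL →
      L.blockTrace k (X * Y) = ∑ p with L.block p = k, ∑ q with L.block q = k, X p q * Y q p := by
    intro X Y hX hY
    refine Finset.sum_congr rfl fun p hp => ?_
    rw [Matrix.mul_apply]
    symm
    apply Finset.sum_subset (Finset.subset_univ _)
    intro q _ hq
    have hp' : L.block p = k := by simpa using hp
    have hq' : L.block q ≠ k := by simpa using hq
    by_cases h1 : (p, q) ∈ L.support
    · by_cases h2 : (q, p) ∈ L.support
      · exact absurd (le_antisymm (hL.block_le h2) (hL.block_le h1)) (by rw [hp']; exact hq')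
      · rw [hY q p h2, mul_zero]
    · rw [hX p q h1, zero_mul]
  have hsub : L.blockTrace k ⁅A, B⁆ = L.blockTrace k (A * B) - L.blockTrace k (B * A) := by
    simp [blockTrace, Ring.lie_def, Finset.sum_sub_distrib]
  rw [hsub, key A B hA hB, key B A hB hA, sub_eq_zero, Finset.sum_comm]
  exact Finset.sum_congr rfl fun p _ => Finset.sum_congr rfl fun q _ => mul_comm _ _

/-- The Lie algebra `M_L^0` of all matrices in `M_L` that have zero trace on every diagonal block
with respect to the partition of `L`. -/
def lieAlgZero (L : Ladder n) (hL : L.IsUpperTriangular) :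
    LieSubalgebra F (Matrix (Fin n) (Fin n) F) where
  carrier := {A | A ∈ L.lieAlg F hL ∧ ∀ k, L.blockTrace k A = 0}
  zero_mem' := ⟨(L.lieAlg F hL).zero_mem, fun k => by simp [blockTrace]⟩
  add_mem' := fun {A B} hA hB => ⟨(L.lieAlg F hL).add_mem hA.1 hB.1, fun k => by
    have h1 := hA.2 k
    have h2 := hB.2 k
    simp only [blockTrace, Matrix.add_apply, Finset.sum_add_distrib] at *
    rw [h1, h2, add_zero]⟩
  smul_mem' := fun c A hA => ⟨(L.lieAlg F hL).smul_mem c hA.1, fun k => by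
    have h1 := hA.2 k
    simp only [blockTrace, Matrix.smul_apply, ← Finset.smul_sum] at *
    rw [h1, smul_zero]⟩
  lie_mem' := fun {A B} hA hB =>
    ⟨(L.lieAlg F hL).lie_mem hA.1 hB.1, fun k => hL.blockTrace_lie k hA.1 hB.1⟩

theorem lieAlgZero_le (L : Ladder n) (hL : L.IsUpperTriangular) :
    L.lieAlgZero F hL ≤ L.lieAlg F hL := fun _ hA => hA.1

/-- A matrix is block upper triangular with respect to the partition of `L` if all its blocks below
the diagonal ones vanish. -/
def IsBlockUpper {F : Type*} [Field F] (L : Ladder n) (X : Matrix (Fin n) (Fin n) F) : Prop :=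
  X.BlockTriangular L.block

end Ladder

/-!
The entries of `M_L` are those of the block upper triangular matrices, except for the diagonal
blocks that do not lie in the support. Hence block upper triangular matrices normalize `M_L`
(`Ladder.IsBlockUpper.lie_mem`). A diagonal block in the support has size at least two, and this
makes the relations between matrix units rich enough. They give `M_L^0 = [M_L, M_L]`
(`Ladder.IsSDUT.mem_derived_iff`), and they show that a matrix commuting with `M_L^0` commutes with
`M_L` (`Ladder.IsSDUT.mem_lieCentralizer`). So everything follows from the third claim, that a
derivation `φ` of `M_L^0` is `ad X` for a block upper triangular `X`: such an `ad X` is defined on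
all of `M_L`, and `X ↦ ad X` is a surjection of the normalizer of `M_L` onto the derivation algebra
of `M_L^0` with the centralizer as its kernel.

The matrix `X` is found by subtracting inner derivations from `φ` until nothing remains. Say that
an index is diagonal if its diagonal position belongs to the support. The torus is spanned by the
matrices `E_uu - E_vv` with `u`, `v` in the same diagonal block of the support.

* The torus acts on every position off the diagonal with a diagonal row or column index by a nonzero
  weight. A cocycle on a diagonalizable commutative algebra is a coboundary outside of weight zero,
  so `φ` may be assumed to vanish on the torus at those positions
  (`Ladder.IsDerivationOn.exists_torus_correction`).
* For distinct diagonal `p`, `q` the position `(p, q)` is determined within the support by its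
  weights; this is where the characteristic must not be `2` or `3`. Hence `φ(E_pq) = c_pq E_pq`, and
  then `φ` vanishes on the torus. The `c_pq` form a cocycle, so they are differences `x_p - x_q`,
  and subtracting `ad` of a diagonal matrix kills them
  (`Ladder.IsDerivationOn.exists_diagonal_correction`).
* For `g` not diagonal and `d` diagonal, `φ(E_gd)` is now a combination of the `E_rd` with `r` not
  diagonal, and the coefficients do not depend on `d`. They are the entries of a block upper
  triangular matrix (`Ladder.IsDerivationOn.exists_col_correction`). The same holds for the `E_dg`,
  and this last correction does not disturb the preceding one
  (`Ladder.IsDerivationOn.exists_row_correction`).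
* The matrix units with a diagonal row or column index generate `M_L^0`, so `φ` is now zero.

No invariant form or complete reducibility enters, so the sizes of the blocks may be divisible by
the characteristic.
-/

/-! ### Commutators with matrix units and diagonal matrices -/

namespace Matrix

variable {F : Type*} [Field F] {n : ℕ}

theorem lie_single_apply (A : Matrix (Fin n) (Fin n) F) (p q r s : Fin n) :
    ⁅A, single p q (1 : F)⁆ r s =
      (if s = q then A r p else 0) - (if r = p then A q s else 0) := by
  rw [Ring.lie_def, sub_apply, mul_apply, mul_apply]
  simp only [single_apply, ite_and, mul_ite, ite_mul, mul_one, mul_zero, one_mul, zero_mul]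
  congr 1
  · simp [eq_comm]
  · by_cases h : r = p
    · subst h; simp
    · simp [h, Ne.symm h]

theorem single_lie_apply (A : Matrix (Fin n) (Fin n) F) (p q r s : Fin n) :
    ⁅single p q (1 : F), A⁆ r s =
      (if r = p then A q s else 0) - (if s = q then A r p else 0) := by
  rw [← lie_skew, neg_apply, lie_single_apply, neg_sub]

theorem diagonal_lie_apply (w : Fin n → F) (A : Matrix (Fin n) (Fin n) F) (r s : Fin n) :
    ⁅diagonal w, A⁆ r s = (w r - w s) * A r s := by
  rw [Ring.lie_def, sub_apply, diagonal_mul, mul_diagonal]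
  ring

theorem lie_diagonal_apply (w : Fin n → F) (A : Matrix (Fin n) (Fin n) F) (r s : Fin n) :
    ⁅A, diagonal w⁆ r s = (w s - w r) * A r s := by
  rw [Ring.lie_def, sub_apply, diagonal_mul, mul_diagonal]
  ring

theorem diagonal_lie_single (w : Fin n → F) (p q : Fin n) :
    ⁅diagonal w, single p q (1 : F)⁆ = (w p - w q) • single p q (1 : F) := by
  ext r s
  rw [diagonal_lie_apply, smul_apply, smul_eq_mul, single_apply]
  split_ifs with h
  · rw [h.1, h.2]
  · simp

theorem single_lie_single {p r : Fin n} (q : Fin n) (h : p ≠ r) :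
    ⁅single p q (1 : F), single q r (1 : F)⁆ = single p r (1 : F) := by
  rw [Ring.lie_def, single_mul_single_same, single_mul_single_of_ne _ _ _ _ h.symm, sub_zero,
    one_mul]

theorem single_lie_single_of_ne {p q r s : Fin n} (h : q ≠ r) (h' : s ≠ p) :
    ⁅single p q (1 : F), single r s (1 : F)⁆ = 0 := by
  rw [Ring.lie_def, single_mul_single_of_ne _ _ _ _ h, single_mul_single_of_ne _ _ _ _ h',
    sub_zero]

theorem single_lie_single_swap (p q : Fin n) :
    ⁅single p q (1 : F), single q p (1 : F)⁆ =
      diagonal (Pi.single p 1 - Pi.single q 1 : Fin n → F) := by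
  rw [Ring.lie_def, single_mul_single_same, single_mul_single_same, one_mul, Pi.sub_def,
    ← diagonal_sub, diagonal_single, diagonal_single]

theorem eq_smul_single {A : Matrix (Fin n) (Fin n) F} {p q : Fin n}
    (h : ∀ r s, ¬(r = p ∧ s = q) → A r s = 0) : A = A p q • single p q (1 : F) := by
  ext r s
  by_cases hrs : r = p ∧ s = q
  · rw [hrs.1, hrs.2]
    simp
  · rw [h r s hrs, Matrix.smul_apply, single_apply, if_neg fun h => hrs ⟨h.1.symm, h.2.symm⟩,
      smul_zero]

end Matrix

/-! ### Combinatorics of ladders -/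

namespace Ladder

variable {n : ℕ} {L : Ladder n}

theorem block_lt_of_cut {p q : Fin n} {c : ℕ} (hc : c ∈ L.cuts) (hp : (p : ℕ) < c)
    (hq : c ≤ (q : ℕ)) : L.block p < L.block q := by
  apply Finset.card_lt_card
  rw [Finset.ssubset_iff_of_subset]
  · exact ⟨c, Finset.mem_filter.2 ⟨hc, hq⟩, fun h => absurd (Finset.mem_filter.1 h).2 (by omega)⟩
  · intro d hd
    rw [Finset.mem_filter] at hd ⊢
    exact ⟨hd.1, by omega⟩

theorem mem_cuts {c : ℕ} : c ∈ L.cuts ↔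
    ((∃ l, (L.row l : ℕ) + 1 = c) ∨ ∃ l, (L.col l : ℕ) = c) ∧ c ≠ 0 ∧ c ≠ n := by
  simp [cuts]

theorem le_row_of_block_le {p q : Fin n} {l : Fin L.step} (h : L.block p ≤ L.block q)
    (hq : q ≤ L.row l) : p ≤ L.row l := by
  by_contra hp
  rw [not_le, Fin.lt_def] at hp
  rw [Fin.le_def] at hq
  have hc : (L.row l : ℕ) + 1 ∈ L.cuts := mem_cuts.2 ⟨.inl ⟨l, rfl⟩, by omega, by omega⟩
  exact absurd (block_lt_of_cut (p := q) (q := p) hc (by omega) (by omega)) (by omega)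

theorem col_le_of_block_le {p q : Fin n} {l : Fin L.step} (h : L.block p ≤ L.block q)
    (hp : L.col l ≤ p) : L.col l ≤ q := by
  by_contra hq
  rw [not_le, Fin.lt_def] at hq
  rw [Fin.le_def] at hp
  have hc : (L.col l : ℕ) ∈ L.cuts := mem_cuts.2 ⟨.inr ⟨l, rfl⟩, by omega, by omega⟩
  exact absurd (block_lt_of_cut (p := q) (q := p) hc (by omega) (by omega)) (by omega)

theorem mem_support_of_block_le_left {p q r : Fin n} (h : L.block p ≤ L.block q)
    (hqr : (q, r) ∈ L.support) : (p, r) ∈ L.support := by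
  obtain ⟨l, h1, h2⟩ := hqr
  exact ⟨l, le_row_of_block_le h h1, h2⟩

theorem mem_support_of_block_le_right {p q r : Fin n} (h : L.block p ≤ L.block q)
    (hrp : (r, p) ∈ L.support) : (r, q) ∈ L.support := by
  obtain ⟨l, h1, h2⟩ := hrp
  exact ⟨l, h1, col_le_of_block_le h h2⟩

theorem IsSDUT.exists_partner (hL : L.IsSDUT) {p : Fin n} (hp : (p, p) ∈ L.support) :
    ∃ q, p ≠ q ∧ (p, q) ∈ L.support ∧ (q, p) ∈ L.support := by
  obtain ⟨l, h1, h2⟩ := hp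
  have h := hL.col_lt_row l
  by_cases hp : p = L.col l
  · exact ⟨L.row l, by rw [hp]; exact h.ne, ⟨l, h1, h.le⟩, ⟨l, le_rfl, h2⟩⟩
  · exact ⟨L.col l, hp, ⟨l, h1, le_rfl⟩, ⟨l, h.le, h2⟩⟩

theorem mem_support_or_swap {p q : Fin n} (hp : (p, p) ∈ L.support) (hq : (q, q) ∈ L.support) :
    (p, q) ∈ L.support ∨ (q, p) ∈ L.support := by
  obtain ⟨l, h1, h2⟩ := hp
  obtain ⟨m, h3, h4⟩ := hq
  rcases le_total l m with h | h
  · exact .inl ⟨m, h1.trans (L.row_strictMono.monotone h), h4⟩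
  · exact .inr ⟨l, h3.trans (L.row_strictMono.monotone h), h2⟩

theorem IsSDUT.exists_between (hL : L.IsSDUT) {p q : Fin n} (h : (p, q) ∈ L.support) :
    ∃ d, (d, d) ∈ L.support ∧ (p, d) ∈ L.support ∧ (d, q) ∈ L.support := by
  obtain ⟨l, h1, h2⟩ := h
  have h := (hL.col_lt_row l).le
  exact ⟨L.col l, ⟨l, h, le_rfl⟩, ⟨l, h1, le_rfl⟩, ⟨l, h, h2⟩⟩

theorem IsSDUT.exists_least (hL : L.IsSDUT) {p : Fin n} (hp : (p, p) ∈ L.support) :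
    ∃ d, (d, d) ∈ L.support ∧ ∀ q, (q, q) ∈ L.support → (d, q) ∈ L.support := by
  obtain ⟨l, -, -⟩ := hp
  have h0 : 0 < L.step := l.pos
  have h := (hL.col_lt_row ⟨0, h0⟩).le
  refine ⟨L.col ⟨0, h0⟩, ⟨_, h, le_rfl⟩, ?_⟩
  rintro q ⟨m, -, h2⟩
  exact ⟨m, h.trans (L.row_strictMono.monotone (Fin.le_def.2 (Nat.zero_le _))), h2⟩

/-- For a row `r` whose diagonal position lies outside of the support, `block r ≤ block g` can be
tested on the columns of the support that meet the diagonal. -/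
theorem IsSDUT.block_le_of_rows (hL : L.IsSDUT) {r g : Fin n} (hr : (r, r) ∉ L.support)
    (h : ∀ d, (d, d) ∈ L.support → (g, d) ∈ L.support → (r, d) ∈ L.support) :
    L.block r ≤ L.block g := by
  have key : ∀ l, g ≤ L.row l → r ≤ L.row l := by
    intro l hl
    have hcr := (hL.col_lt_row l).le
    obtain ⟨m, h1, h2⟩ := h (L.row l) ⟨l, le_rfl, hcr⟩ ⟨l, hl, hcr⟩
    rcases le_or_gt m l with hm | hm
    · exact h1.trans (L.row_strictMono.monotone hm)
    · exact absurd h2 (not_le.2 (hL.isUpperTriangular.row_lt_col hm))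
  apply Finset.card_le_card
  intro c hc
  rw [Finset.mem_filter] at hc ⊢
  refine ⟨hc.1, ?_⟩
  by_contra hcg
  obtain ⟨⟨l, hl⟩ | ⟨l, hl⟩, -⟩ := mem_cuts.1 hc.1
  · have := Fin.le_def.1 (key l (Fin.le_def.2 (by omega)))
    omega
  · have h1 := Fin.lt_def.1 (hL.col_lt_row l)
    exact hr ⟨l, key l (Fin.le_def.2 (by omega)), Fin.le_def.2 (show _ ≤ (r : ℕ) by omega)⟩

/-- For a column `r` whose diagonal position lies outside of the support, `block g ≤ block r` can be
tested on the rows of the support that meet the diagonal. -/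
theorem IsSDUT.block_le_of_cols (hL : L.IsSDUT) {r g : Fin n} (hr : (r, r) ∉ L.support)
    (h : ∀ d, (d, d) ∈ L.support → (d, g) ∈ L.support → (d, r) ∈ L.support) :
    L.block g ≤ L.block r := by
  have key : ∀ l, L.col l ≤ g → L.col l ≤ r := by
    intro l hl
    have hcr := (hL.col_lt_row l).le
    obtain ⟨m, h1, h2⟩ := h (L.col l) ⟨l, hcr, le_rfl⟩ ⟨l, hcr, hl⟩
    rcases le_or_gt l m with hm | hm
    · exact (L.col_strictMono.monotone hm).trans h2
    · exact absurd h1 (not_le.2 (hL.isUpperTriangular.row_lt_col hm))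
  apply Finset.card_le_card
  intro c hc
  rw [Finset.mem_filter] at hc ⊢
  refine ⟨hc.1, ?_⟩
  by_contra hcr
  obtain ⟨⟨l, hl⟩ | ⟨l, hl⟩, -⟩ := mem_cuts.1 hc.1
  · have h1 := Fin.lt_def.1 (hL.col_lt_row l)
    exact hr ⟨l, Fin.le_def.2 (show (r : ℕ) ≤ _ by omega), key l (Fin.le_def.2 (by omega))⟩
  · have := Fin.le_def.1 (key l (Fin.le_def.2 (by omega)))
    omega

end Ladder

/-! ### The Lie algebras of a ladder -/

namespace Ladder

open Matrix

variable {F : Type*} [Field F] {n : ℕ} {L : Ladder n}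

theorem single_mem_lieAlg (hL : L.IsUpperTriangular) {p q : Fin n} (h : (p, q) ∈ L.support) :
    single p q (1 : F) ∈ L.lieAlg F hL := by
  intro r s hrs
  rw [single_apply, if_neg]
  rintro ⟨rfl, rfl⟩
  exact hrs h

theorem single_mem_lieAlgZero (hL : L.IsUpperTriangular) {p q : Fin n} (h : (p, q) ∈ L.support)
    (hpq : p ≠ q) : single p q (1 : F) ∈ L.lieAlgZero F hL := by
  refine ⟨single_mem_lieAlg hL h, fun k => Finset.sum_eq_zero fun r _ => ?_⟩
  rw [single_apply, if_neg]
  rintro ⟨rfl, rfl⟩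
  exact hpq rfl

theorem diagonal_mem_lieAlgZero (hL : L.IsUpperTriangular) {p q : Fin n} (h : (p, q) ∈ L.support)
    (h' : (q, p) ∈ L.support) (hpq : p ≠ q) :
    diagonal (Pi.single p 1 - Pi.single q 1 : Fin n → F) ∈ L.lieAlgZero F hL := by
  rw [← single_lie_single_swap]
  exact (L.lieAlgZero F hL).lie_mem (single_mem_lieAlgZero hL h hpq)
    (single_mem_lieAlgZero hL h' hpq.symm)

/-- `M_L^0` is spanned by the matrix units off the diagonal and the differences of two diagonal
matrix units of the same block. -/
theorem lieAlgZero_le_of_single_mem (hL : L.IsUpperTriangular)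
    {N : Submodule F (Matrix (Fin n) (Fin n) F)}
    (h1 : ∀ p q, (p, q) ∈ L.support → p ≠ q → single p q (1 : F) ∈ N)
    (h2 : ∀ p q, (p, q) ∈ L.support → (q, p) ∈ L.support → p ≠ q →
      diagonal (Pi.single p 1 - Pi.single q 1 : Fin n → F) ∈ N)
    {A : Matrix (Fin n) (Fin n) F} (hA : A ∈ L.lieAlgZero F hL) : A ∈ N := by
  rcases isEmpty_or_nonempty (Fin n) with hn | hn
  · rw [Subsingleton.elim A 0]
    exact N.zero_mem
  -- `rep k` is an index of the `k`-th block
  let rep : ℕ → Fin n := Function.invFun L.block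
  have hrep : ∀ p, L.block (rep (L.block p)) = L.block p := fun p =>
    Function.invFun_eq ⟨p, rfl⟩
  -- since the block traces vanish, `A` does not change when each `E_pp` is replaced by
  -- `E_pp - E_rr` with `r` the representative of the block of `p`
  have h0 : ∑ p, A p p • single (rep (L.block p)) (rep (L.block p)) (1 : F) = 0 := by
    rw [← Finset.sum_fiberwise_of_maps_to (t := Finset.univ.image L.block) (g := L.block)
      (fun p _ => Finset.mem_image_of_mem _ (Finset.mem_univ p))]
    refine Finset.sum_eq_zero fun k _ => ?_
    have : ∀ p ∈ Finset.univ.filter (fun p => L.block p = k),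
        A p p • single (rep (L.block p)) (rep (L.block p)) (1 : F) =
          A p p • single (rep k) (rep k) (1 : F) := fun p hp => by
      rw [(Finset.mem_filter.1 hp).2]
    rw [Finset.sum_congr rfl this, ← Finset.sum_smul]
    have hk : ∑ p with L.block p = k, A p p = 0 := hA.2 k
    rw [hk, zero_smul]
  have hsum : A = ∑ p, (A p p • (single p p (1 : F) -
      single (rep (L.block p)) (rep (L.block p)) (1 : F)) +
        ∑ q ∈ Finset.univ.erase p, A p q • single p q (1 : F)) := by
    simp only [smul_sub, Finset.sum_add_distrib, Finset.sum_sub_distrib, h0, sub_zero]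
    rw [← Finset.sum_add_distrib]
    conv_lhs => rw [matrix_eq_sum_single A]
    refine Finset.sum_congr rfl fun p _ => ?_
    rw [← Finset.add_sum_erase _ _ (Finset.mem_univ p)]
    simp [smul_single]
  rw [hsum]
  refine N.sum_mem fun p _ => N.add_mem ?_ (N.sum_mem fun q hq => ?_)
  · by_cases hp : (p, p) ∈ L.support
    · by_cases hpr : p = rep (L.block p)
      · rw [← hpr, sub_self, smul_zero]
        exact N.zero_mem
      · have h := h2 p (rep (L.block p)) (mem_support_of_block_le_right (hrep p).ge hp)
          (mem_support_of_block_le_left (hrep p).le hp) hpr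
        rw [Pi.sub_def, ← diagonal_sub, diagonal_single, diagonal_single] at h
        exact N.smul_mem _ h
    · rw [hA.1 p p hp, zero_smul]
      exact N.zero_mem
  · by_cases hpq : (p, q) ∈ L.support
    · exact N.smul_mem _ (h1 p q hpq (Finset.ne_of_mem_erase hq).symm)
    · rw [hA.1 p q hpq, zero_smul]
      exact N.zero_mem

end Ladder

/-! ### The normalizer and the centralizer -/

namespace Ladder

open Matrix

variable {F : Type*} [Field F] {n : ℕ} {L : Ladder n}

theorem IsBlockUpper.lie_mem {X B : Matrix (Fin n) (Fin n) F} (hX : L.IsBlockUpper X)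
    (hL : L.IsUpperTriangular) (hB : B ∈ L.lieAlg F hL) : ⁅X, B⁆ ∈ L.lieAlg F hL := by
  have hX' : ∀ p q, X p q ≠ 0 → L.block p ≤ L.block q := fun p q h => by
    by_contra hlt
    exact h (hX (not_le.1 hlt))
  intro p q hpq
  rw [Ring.lie_def, Matrix.sub_apply, mul_apply, mul_apply, Finset.sum_eq_zero, Finset.sum_eq_zero,
    sub_zero]
  · intro k _
    by_contra h
    exact hpq (mem_support_of_block_le_right (hX' k q (right_ne_zero_of_mul h))
      (by_contra fun hpk => left_ne_zero_of_mul h (hB p k hpk)))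
  · intro k _
    by_contra h
    exact hpq (mem_support_of_block_le_left (hX' p k (left_ne_zero_of_mul h))
      (by_contra fun hkq => right_ne_zero_of_mul h (hB k q hkq)))

theorem IsBlockUpper.mem_normalizer {X : Matrix (Fin n) (Fin n) F} (hX : L.IsBlockUpper X)
    (hL : L.IsUpperTriangular) : X ∈ (L.lieAlg F hL).normalizer :=
  ((L.lieAlg F hL).mem_normalizer_iff X).2 fun _ hB => hX.lie_mem hL hB

theorem isBlockUpper_of_mem_support (hL : L.IsUpperTriangular) {X : Matrix (Fin n) (Fin n) F}
    (h : ∀ p q, X p q ≠ 0 → (p, q) ∈ L.support) : L.IsBlockUpper X := fun p q hpq => by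
  by_contra hX
  exact absurd (hL.block_le (h p q hX)) (not_le.2 hpq)

theorem IsBlockUpper.add {X Y : Matrix (Fin n) (Fin n) F} (hX : L.IsBlockUpper X)
    (hY : L.IsBlockUpper Y) : L.IsBlockUpper (X + Y) := BlockTriangular.add hX hY

/-- A matrix that commutes with `M_L^0` commutes with `M_L`, because a diagonal matrix unit in `M_L`
is an associative product of two matrix units off the diagonal. -/
theorem IsSDUT.mem_lieCentralizer (hL : L.IsSDUT) {X : Matrix (Fin n) (Fin n) F}
    (hX : ∀ B ∈ L.lieAlgZero F hL.isUpperTriangular, ⁅X, B⁆ = 0) :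
    X ∈ lieCentralizer (L.lieAlg F hL.isUpperTriangular) := by
  have hoff : ∀ p q, (p, q) ∈ L.support → p ≠ q → ⁅X, single p q (1 : F)⁆ = 0 :=
    fun p q h hpq => hX _ (single_mem_lieAlgZero _ h hpq)
  have hall : ∀ p q, (p, q) ∈ L.support → Commute X (single p q (1 : F)) := by
    intro p q h
    by_cases hpq : p = q
    · subst hpq
      obtain ⟨r, hr, h1, h2⟩ := hL.exists_partner h
      have := (commute_iff_lie_eq.2 (hoff p r h1 hr)).mul_right
        (commute_iff_lie_eq.2 (hoff r p h2 hr.symm))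
      rwa [single_mul_single_same, one_mul] at this
    · exact commute_iff_lie_eq.2 (hoff p q h hpq)
  intro B hB
  rw [← commute_iff_lie_eq, matrix_eq_sum_single B]
  refine Commute.sum_right _ _ _ fun p _ => Commute.sum_right _ _ _ fun q _ => ?_
  by_cases h : (p, q) ∈ L.support
  · have := (hall p q h).smul_right (B p q)
    rwa [smul_single, smul_eq_mul, mul_one] at this
  · rw [hB p q h, single_zero]
    exact Commute.zero_right X

/-! ### The derived algebra -/

theorem IsSDUT.mem_derived_iff (hL : L.IsSDUT) (A : L.lieAlg F hL.isUpperTriangular) :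
    A ∈ ⁅(⊤ : LieIdeal F (L.lieAlg F hL.isUpperTriangular)),
        (⊤ : LieIdeal F (L.lieAlg F hL.isUpperTriangular))⁆ ↔
      (A : Matrix (Fin n) (Fin n) F) ∈ L.lieAlgZero F hL.isUpperTriangular := by
  rw [← LieSubmodule.mem_toSubmodule, LieSubmodule.lieIdeal_oper_eq_linear_span']
  constructor
  · intro h
    have hle : Submodule.span F {x | ∃ y ∈ (⊤ : LieIdeal F (L.lieAlg F hL.isUpperTriangular)),
        ∃ z ∈ (⊤ : LieIdeal F (L.lieAlg F hL.isUpperTriangular)), ⁅y, z⁆ = x} ≤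
        (L.lieAlgZero F hL.isUpperTriangular).toSubmodule.comap
          (L.lieAlg F hL.isUpperTriangular).toSubmodule.subtype := by
      rw [Submodule.span_le]
      rintro _ ⟨y, -, z, -, rfl⟩
      exact ⟨⁅y, z⁆.2, fun k => hL.isUpperTriangular.blockTrace_lie k y.2 z.2⟩
    exact hle h
  · intro hA
    set N := Submodule.span F {x | ∃ y ∈ (⊤ : LieIdeal F (L.lieAlg F hL.isUpperTriangular)),
        ∃ z ∈ (⊤ : LieIdeal F (L.lieAlg F hL.isUpperTriangular)), ⁅y, z⁆ = x}
    have hlie : ∀ x y (hx : x ∈ L.lieAlg F hL.isUpperTriangular)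
        (hy : y ∈ L.lieAlg F hL.isUpperTriangular),
        ⁅x, y⁆ ∈ N.map (L.lieAlg F hL.isUpperTriangular).toSubmodule.subtype := fun x y hx hy =>
      ⟨⁅⟨x, hx⟩, ⟨y, hy⟩⁆, Submodule.subset_span ⟨_, trivial, _, trivial, rfl⟩, rfl⟩
    have hmem : (A : Matrix (Fin n) (Fin n) F) ∈
        N.map (L.lieAlg F hL.isUpperTriangular).toSubmodule.subtype := by
      refine lieAlgZero_le_of_single_mem hL.isUpperTriangular ?_ ?_ hA
      · intro p q h hpq
        obtain ⟨d, -, h1, h2⟩ := hL.exists_between h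
        by_cases hd : d = p ∨ d = q
        -- one of the indices lies on a diagonal block of the support, and `E_pq` is an eigenvector
        -- of its diagonal matrix unit
        · rcases hd with rfl | rfl
          · have := hlie _ _ (single_mem_lieAlg (F := F) _ h1) (single_mem_lieAlg _ h)
            rwa [single_lie_single _ hpq] at this
          · have := hlie _ _ (single_mem_lieAlg (F := F) _ h) (single_mem_lieAlg _ h2)
            rwa [single_lie_single _ hpq] at this
        · have := hlie _ _ (single_mem_lieAlg (F := F) _ h1) (single_mem_lieAlg _ h2)
          rwa [single_lie_single _ hpq] at this
      · intro p q h h' hpq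
        rw [← single_lie_single_swap]
        exact hlie _ _ (single_mem_lieAlg _ h) (single_mem_lieAlg _ h')
    obtain ⟨B, hB, hBA⟩ := hmem
    rwa [Subtype.ext hBA] at hB

end Ladder

/-! ### Derivations as linear maps of the matrix algebra -/

namespace Ladder

open Matrix

variable {F : Type*} [Field F] {n : ℕ} {L : Ladder n}

/-- The linear map `φ` of the space of all matrices restricts to a derivation of `M_L^0` with
values in `M_L`; its values outside of `M_L^0` do not matter. -/
structure IsDerivationOn (L : Ladder n) (hL : L.IsUpperTriangular)
    (φ : Matrix (Fin n) (Fin n) F →ₗ[F] Matrix (Fin n) (Fin n) F) : Prop where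
  mem : ∀ A ∈ L.lieAlgZero F hL, φ A ∈ L.lieAlg F hL
  leibniz : ∀ A ∈ L.lieAlgZero F hL, ∀ B ∈ L.lieAlgZero F hL, φ ⁅A, B⁆ = ⁅φ A, B⁆ + ⁅A, φ B⁆

namespace IsDerivationOn

variable {φ : Matrix (Fin n) (Fin n) F →ₗ[F] Matrix (Fin n) (Fin n) F}

theorem sub_ad {hL : L.IsUpperTriangular} (hφ : L.IsDerivationOn hL φ)
    {X : Matrix (Fin n) (Fin n) F} (hX : L.IsBlockUpper X) :
    L.IsDerivationOn hL (φ - LieAlgebra.ad F _ X) where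
  mem A hA := by
    rw [LinearMap.sub_apply, LieAlgebra.ad_apply]
    exact (L.lieAlg F hL).sub_mem (hφ.mem A hA) (hX.lie_mem hL hA.1)
  leibniz A hA B hB := by
    simp only [LinearMap.sub_apply, LieAlgebra.ad_apply]
    rw [hφ.leibniz A hA B hB, leibniz_lie X A B, sub_lie, lie_sub]
    abel

theorem mem_support {hL : L.IsUpperTriangular} (hφ : L.IsDerivationOn hL φ)
    {A : Matrix (Fin n) (Fin n) F} (hA : A ∈ L.lieAlgZero F hL) {r s : Fin n}
    (h : φ A r s ≠ 0) : (r, s) ∈ L.support :=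
  by_contra fun hrs => h (hφ.mem A hA r s hrs)

/-- The effect of `φ` on the eigenvalue equation `[w, E_pq] = (w_p - w_q) E_pq`. -/
theorem weight_eq {hL : L.IsUpperTriangular} (hφ : L.IsDerivationOn hL φ) {w : Fin n → F}
    (hw : diagonal w ∈ L.lieAlgZero F hL) {p q : Fin n} (h : (p, q) ∈ L.support) (hpq : p ≠ q)
    (r s : Fin n) :
    (w p - w q) * φ (single p q 1) r s = ⁅φ (diagonal w), single p q (1 : F)⁆ r s +
      (w r - w s) * φ (single p q 1) r s := by
  have := congrFun (congrFun (hφ.leibniz _ hw _ (single_mem_lieAlgZero hL h hpq)) r) s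
  rwa [diagonal_lie_single, map_smul, Matrix.smul_apply, smul_eq_mul, Matrix.add_apply,
    diagonal_lie_apply] at this

theorem apply_eq_zero_of_weight_ne {hL : L.IsUpperTriangular} (hφ : L.IsDerivationOn hL φ)
    {w : Fin n → F} (hw : diagonal w ∈ L.lieAlgZero F hL) (hw0 : φ (diagonal w) = 0)
    {p q : Fin n} (h : (p, q) ∈ L.support) (hpq : p ≠ q) {r s : Fin n}
    (hne : w r - w s ≠ w p - w q) : φ (single p q 1) r s = 0 := by
  have := hφ.weight_eq hw h hpq r s
  rw [hw0, zero_lie, Matrix.zero_apply, zero_add] at this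
  by_contra h0
  exact hne (mul_right_cancel₀ h0 this).symm

/-! ### Normalizing a derivation on the torus -/

/-- The torus spanned by the differences `E_uu - E_vv` acts with nonzero weight on every position
off the diagonal in whose row or column the diagonal position belongs to the support. So, as the
torus is commutative, a derivation can be corrected to vanish there on the torus. -/
theorem exists_torus_correction (h2 : (2 : F) ≠ 0) (hL : L.IsSDUT)
    (hφ : L.IsDerivationOn hL.isUpperTriangular φ) :
    ∃ X : Matrix (Fin n) (Fin n) F, L.IsBlockUpper X ∧
      ∀ r s, r ≠ s → ((r, r) ∈ L.support ∨ (s, s) ∈ L.support) →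
        ∀ u v, (u, v) ∈ L.support → (v, u) ∈ L.support → u ≠ v →
          (φ - LieAlgebra.ad F _ X) (diagonal (Pi.single u 1 - Pi.single v 1)) r s = 0 := by
  have hcomm : ∀ w w' : Fin n → F, diagonal w ∈ L.lieAlgZero F hL.isUpperTriangular →
      diagonal w' ∈ L.lieAlgZero F hL.isUpperTriangular → ∀ r s,
      (w r - w s) * φ (diagonal w') r s = (w' r - w' s) * φ (diagonal w) r s := by
    intro w w' hw hw' r s
    have h0 : ⁅diagonal w, diagonal w'⁆ = 0 := by
      rw [← commute_iff_lie_eq]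
      exact commute_diagonal w w'
    have := congrFun (congrFun (hφ.leibniz _ hw _ hw') r) s
    rw [h0, map_zero, Matrix.zero_apply, Matrix.add_apply, lie_diagonal_apply,
      diagonal_lie_apply] at this
    linear_combination -this
  have hex : ∀ r s, ∃ x : F, (x ≠ 0 → (r, s) ∈ L.support) ∧
      (r ≠ s → ((r, r) ∈ L.support ∨ (s, s) ∈ L.support) → ∀ w : Fin n → F,
        diagonal w ∈ L.lieAlgZero F hL.isUpperTriangular →
          φ (diagonal w) r s = (w s - w r) * x) := by
    intro r s
    by_cases hrs : r ≠ s ∧ ((r, r) ∈ L.support ∨ (s, s) ∈ L.support)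
    · obtain ⟨w, hw, hne⟩ : ∃ w : Fin n → F,
          diagonal w ∈ L.lieAlgZero F hL.isUpperTriangular ∧ w s - w r ≠ 0 := by
        obtain ⟨hrs, hr | hs⟩ := hrs
        · obtain ⟨t, ht, h1, h3⟩ := hL.exists_partner hr
          refine ⟨_, diagonal_mem_lieAlgZero _ h3 h1 ht.symm, ?_⟩
          by_cases hst : s = t
          · subst hst
            simp [ht, ht.symm]
            norm_num [h2]
          · simp [ht, hrs.symm, hst]
        · obtain ⟨t, ht, h1, h3⟩ := hL.exists_partner hs
          refine ⟨_, diagonal_mem_lieAlgZero _ h1 h3 ht, ?_⟩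
          by_cases hrt : r = t
          · subst hrt
            simp [ht, ht.symm]
            norm_num [h2]
          · simp [ht, hrs, hrt]
      refine ⟨φ (diagonal w) r s / (w s - w r), fun h => ?_, fun _ _ w' hw' => ?_⟩
      · exact hφ.mem_support hw (div_ne_zero_iff.1 h).1
      · have := hcomm w w' hw hw' r s
        field_simp
        linear_combination -this
    · exact ⟨0, fun h => absurd rfl h, fun h1 h2 => absurd ⟨h1, h2⟩ hrs⟩
  choose X hX1 hX2 using hex
  refine ⟨of X, isBlockUpper_of_mem_support hL.isUpperTriangular hX1,
    fun r s hrs hD u v huv hvu hne => ?_⟩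
  rw [LinearMap.sub_apply, LieAlgebra.ad_apply, Matrix.sub_apply, lie_diagonal_apply, of_apply,
    hX2 r s hrs hD _ (diagonal_mem_lieAlgZero _ huv hvu hne), sub_self]

/-- Within a diagonal block, the weights of `E_pp - E_qq` lie in `{0, ±1, ±2}`, and only the
position `(p, q)` has weight `2`, as the characteristic is not `2` or `3`. -/
theorem apply_single_of_mem_block (h2 : (2 : F) ≠ 0) (h3 : (3 : F) ≠ 0) (hL : L.IsSDUT)
    (hφ : L.IsDerivationOn hL.isUpperTriangular φ)
    (htor : ∀ r s, r ≠ s → ((r, r) ∈ L.support ∨ (s, s) ∈ L.support) →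
        ∀ u v, (u, v) ∈ L.support → (v, u) ∈ L.support → u ≠ v →
          φ (diagonal (Pi.single u 1 - Pi.single v 1)) r s = 0)
    {p q : Fin n} (h : (p, q) ∈ L.support) (h' : (q, p) ∈ L.support) (hpq : p ≠ q)
    {r s : Fin n} (hrs : ¬(r = p ∧ s = q)) : φ (single p q 1) r s = 0 := by
  have hp := hL.isUpperTriangular.mem_support_trans h h'
  have hq := hL.isUpperTriangular.mem_support_trans h' h
  have h4 : (4 : F) ≠ 0 := by
    have : (4 : F) = 2 * 2 := by norm_num
    rw [this]
    exact mul_ne_zero h2 h2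
  have hw := diagonal_mem_lieAlgZero (F := F) hL.isUpperTriangular h h' hpq
  have := hφ.weight_eq hw h hpq r s
  have hz : ⁅φ (diagonal (Pi.single p 1 - Pi.single q 1)), single p q (1 : F)⁆ r s = 0 := by
    rw [lie_single_apply]
    by_cases hs : s = q
    · have hr : r ≠ p := fun hr => hrs ⟨hr, hs⟩
      rw [htor r p hr (.inr hp) p q h h' hpq]
      simp [hr]
    · rw [htor q s (Ne.symm hs) (.inl hq) p q h h' hpq]
      simp [hs]
  rw [hz, zero_add] at this
  by_contra h0
  have hcon := mul_right_cancel₀ h0 this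
  -- `1 - 0 - (0 - 1) = 2` is the weight of `(p, q)` as it is left by `simp`
  have key : ∀ x : F, x = 1 ∨ x = 0 ∨ x = -1 ∨ x = -2 → 1 - 0 - (0 - 1) ≠ x := by
    rintro x (rfl | rfl | rfl | rfl) hx
    · exact one_ne_zero (by linear_combination hx : (1 : F) = 0)
    · exact h2 (by linear_combination hx)
    · exact h3 (by linear_combination hx)
    · exact h4 (by linear_combination hx)
  simp only [Pi.sub_apply, Pi.single_apply, hpq, hpq.symm, if_true, if_false] at hcon
  by_cases hrp : r = p <;> by_cases hrq : r = q <;> by_cases hsp : s = p <;>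
    by_cases hsq : s = q <;>
    simp only [hrp, hrq, hsp, hsq, hpq, hpq.symm, if_true, if_false] at hcon <;>
    first
    | exact hrs ⟨hrp, hsq⟩
    | exact hpq (hrp.symm.trans hrq)
    | exact hpq (hsp.symm.trans hsq)
    | (refine key _ ?_ hcon; norm_num)

/-! ### Eigenvalues on the diagonal blocks -/

/-- If `E_pq` and `E_qp` are eigenvectors of `φ`, so is `E_pp - E_qq = [E_pq, E_qp]`; applying `φ` to
`[E_pp - E_qq, E_pq] = 2 E_pq` shows that its eigenvalue is zero. -/
theorem apply_torus_eq_zero (h2 : (2 : F) ≠ 0) (hL : L.IsUpperTriangular)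
    (hφ : L.IsDerivationOn hL φ) {p q : Fin n} (h : (p, q) ∈ L.support)
    (h' : (q, p) ∈ L.support) (hpq : p ≠ q) {c c' : F}
    (hc : φ (single p q 1) = c • single p q (1 : F))
    (hc' : φ (single q p 1) = c' • single q p (1 : F)) :
    c + c' = 0 ∧ φ (diagonal (Pi.single p 1 - Pi.single q 1)) = 0 := by
  have hd : φ (diagonal (Pi.single p 1 - Pi.single q 1)) =
      (c + c') • diagonal (Pi.single p 1 - Pi.single q 1) := by
    rw [← single_lie_single_swap, hφ.leibniz _ (single_mem_lieAlgZero hL h hpq) _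
      (single_mem_lieAlgZero hL h' hpq.symm), hc, hc', smul_lie, lie_smul, add_smul]
  have hw := hφ.weight_eq (diagonal_mem_lieAlgZero hL h h' hpq) h hpq p q
  rw [hd, smul_lie, diagonal_lie_single] at hw
  simp only [Matrix.smul_apply, single_apply, Pi.sub_apply, Pi.single_apply, hpq, hpq.symm,
    smul_eq_mul, and_self, if_true, if_false] at hw
  have h0 : c + c' = 0 := by
    have : (c + c') * 2 = 0 := by linear_combination -hw
    exact (mul_eq_zero.1 this).resolve_right h2
  exact ⟨h0, by rw [hd, h0, zero_smul]⟩

/-- For `p` and `q` on different diagonal blocks, the weights of the two tori determine the position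
`(p, q)` within the support. -/
theorem apply_single_of_not_mem_block (h2 : (2 : F) ≠ 0) (h3 : (3 : F) ≠ 0) (hL : L.IsSDUT)
    (hφ : L.IsDerivationOn hL.isUpperTriangular φ)
    (htor : ∀ u v, (u, v) ∈ L.support → (v, u) ∈ L.support → u ≠ v →
          φ (diagonal (Pi.single u 1 - Pi.single v 1)) = 0)
    {p q : Fin n} (hp : (p, p) ∈ L.support) (hq : (q, q) ∈ L.support)
    (h : (p, q) ∈ L.support) (h' : (q, p) ∉ L.support)
    {r s : Fin n} (hrs : ¬(r = p ∧ s = q)) : φ (single p q 1) r s = 0 := by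
  have htrans := @IsUpperTriangular.mem_support_trans n L hL.isUpperTriangular
  have hpq : p ≠ q := fun e => h' (e ▸ hp)
  obtain ⟨p', hpp, hp1, hp2⟩ := hL.exists_partner hp
  obtain ⟨q', hqq, hq1, hq2⟩ := hL.exists_partner hq
  have hpq' : p ≠ q' := fun e => h' (e ▸ hq1)
  have hqp' : q ≠ p' := fun e => h' (e ▸ hp2)
  by_contra h0
  have hS : (r, s) ∈ L.support :=
    hφ.mem_support (single_mem_lieAlgZero hL.isUpperTriangular h hpq) h0
  have hw := hφ.weight_eq (diagonal_mem_lieAlgZero hL.isUpperTriangular hp1 hp2 hpp) h hpq r s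
  have hw' := hφ.weight_eq (diagonal_mem_lieAlgZero hL.isUpperTriangular hq1 hq2 hqq) h hpq r s
  rw [htor _ _ hp1 hp2 hpp, zero_lie, Matrix.zero_apply, zero_add] at hw
  rw [htor _ _ hq1 hq2 hqq, zero_lie, Matrix.zero_apply, zero_add] at hw'
  replace hw := mul_right_cancel₀ h0 hw
  replace hw' := mul_right_cancel₀ h0 hw'
  simp only [Pi.sub_apply, Pi.single_apply, hpq, hpq.symm, hpp, hqq, hpq', hqp', if_true,
    if_false] at hw hw'
  have key : ∀ a b : F, (a = 0 ∨ a = 1) → (b = 0 ∨ b = 1) → a + b ≠ -1 := by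
    rintro a b (rfl | rfl) (rfl | rfl) hab
    · exact one_ne_zero (by linear_combination hab : (1 : F) = 0)
    · exact h2 (by linear_combination hab)
    · exact h2 (by linear_combination hab)
    · exact h3 (by linear_combination hab)
  have h01 : ∀ P : Prop, ∀ _ : Decidable P, (if P then (1 : F) else 0) = 0 ∨
      (if P then (1 : F) else 0) = 1 := fun P _ => by
    by_cases hP : P <;> simp [hP]
  -- the torus element `E_pp - E_p'p'` has weight `1` on `E_pq`, and weight `0`, `-1` or `-2` on the
  -- positions excluded here; `E_qq - E_q'q'` is used in the same way below
  have hrow : r = p ∨ s = p' := by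
    by_contra! hn
    simp only [hn.1, hn.2, if_false] at hw
    exact key _ _ (h01 (r = p') _) (h01 (s = p) _) (by linear_combination hw)
  have hcol : s = q ∨ r = q' := by
    by_contra! hn
    simp only [hn.1, hn.2, if_false] at hw'
    exact key _ _ (h01 (r = q) _) (h01 (s = q') _) (by linear_combination -hw')
  rcases hrow with hr | hs <;> rcases hcol with hs' | hr'
  · exact hrs ⟨hr, hs'⟩
  · exact hpq' (hr.symm.trans hr')
  · exact hqp' (hs'.symm.trans hs)
  -- the position `(q', p')` has the same weights, but lies below the diagonal blocks
  · rw [hr', hs] at hS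
    exact h' (htrans hq1 (htrans hS hp2))

/-- On a derivation for which all `E_pq` with `p` and `q` on diagonal blocks of the support are
eigenvectors, the eigenvalues are the differences `x_p - x_q` of suitable scalars. -/
theorem exists_diagonal_correction (hL : L.IsSDUT)
    (hφ : L.IsDerivationOn hL.isUpperTriangular φ)
    (heig : ∀ p q, (p, p) ∈ L.support → (q, q) ∈ L.support → (p, q) ∈ L.support → p ≠ q →
      φ (single p q 1) = φ (single p q 1) p q • single p q (1 : F))
    (hskew : ∀ p q, (p, q) ∈ L.support → (q, p) ∈ L.support → p ≠ q →
      φ (single p q 1) p q + φ (single q p 1) q p = 0) :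
    ∃ x : Fin n → F, ∀ p q, (p, p) ∈ L.support → (q, q) ∈ L.support → (p, q) ∈ L.support →
      p ≠ q → (φ - LieAlgebra.ad F _ (diagonal x)) (single p q 1) = 0 := by
  by_cases hne : ∃ p, (p, p) ∈ L.support
  swap
  · exact ⟨0, fun p _ hp => absurd ⟨p, hp⟩ hne⟩
  obtain ⟨_, hp0⟩ := hne
  obtain ⟨d, hd, hdle⟩ := hL.exists_least hp0
  -- `x` is normalized by `x_d = 0`, for an index `d` of the first diagonal block
  let x : Fin n → F := fun q => if q = d then 0 else -φ (single d q 1) d q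
  refine ⟨x, fun p q hp hq h hpq => ?_⟩
  rw [LinearMap.sub_apply, LieAlgebra.ad_apply, diagonal_lie_single, heig p q hp hq h hpq,
    ← sub_smul]
  suffices hx : φ (single p q 1) p q = x p - x q by rw [hx, sub_self, zero_smul]
  by_cases hpd : p = d
  · subst hpd
    simp [x, hpq.symm]
  by_cases hqd : q = d
  · subst hqd
    simp only [x, if_neg hpd, if_true]
    linear_combination hskew p q h (hdle p hp) hpq
  have hadd : φ (single d q 1) =
      (φ (single d p 1) d p + φ (single p q 1) p q) • single d q (1 : F) := by
    rw [← single_lie_single p (Ne.symm hqd), hφ.leibniz _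
      (single_mem_lieAlgZero _ (hdle p hp) (Ne.symm hpd)) _ (single_mem_lieAlgZero _ h hpq),
      heig d p hd hp (hdle p hp) (Ne.symm hpd), heig p q hp hq h hpq, smul_lie, lie_smul,
      ← add_smul]
    simp
  have hadd' : φ (single d q 1) d q = φ (single d p 1) d p + φ (single p q 1) p q := by
    conv_lhs => rw [hadd]
    simp
  simp only [x, if_neg hpd, if_neg hqd]
  linear_combination -hadd'

/-! ### The columns and rows of the diagonal blocks -/

theorem apply_torus_eq_zero_of_apply_single (hL : L.IsUpperTriangular)
    (hφ : L.IsDerivationOn hL φ)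
    (hD : ∀ p q, (p, p) ∈ L.support → (q, q) ∈ L.support → (p, q) ∈ L.support → p ≠ q →
      φ (single p q 1) = 0)
    {p q : Fin n} (h : (p, q) ∈ L.support) (h' : (q, p) ∈ L.support) (hpq : p ≠ q) :
    φ (diagonal (Pi.single p 1 - Pi.single q 1)) = 0 := by
  have hp := hL.mem_support_trans h h'
  have hq := hL.mem_support_trans h' h
  rw [← single_lie_single_swap, hφ.leibniz _ (single_mem_lieAlgZero hL h hpq) _
    (single_mem_lieAlgZero hL h' hpq.symm), hD p q hp hq h hpq, hD q p hq hp h' hpq.symm,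
    zero_lie, lie_zero, add_zero]

/-- For `g` outside of and `d` on the diagonal blocks of the support, `φ(E_gd)` is concentrated in
column `d` and in rows outside of those blocks. For `d' ≠ d` in the block of `d`, the relation
`E_gd = [E_gd', E_d'd]` leaves only column `d` and row `d'`, the weights exclude the entries of
column `d` in rows of diagonal blocks, and `[E_gd, E_gd'] = 0` excludes the row `d'`. -/
theorem apply_single_col (h2 : (2 : F) ≠ 0) (hL : L.IsSDUT)
    (hφ : L.IsDerivationOn hL.isUpperTriangular φ)
    (hD : ∀ p q, (p, p) ∈ L.support → (q, q) ∈ L.support → (p, q) ∈ L.support → p ≠ q →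
      φ (single p q 1) = 0)
    {g d : Fin n} (hg : (g, g) ∉ L.support) (hd : (d, d) ∈ L.support) (h : (g, d) ∈ L.support)
    {r s : Fin n} (hrs : s ≠ d ∨ (r, r) ∈ L.support) : φ (single g d 1) r s = 0 := by
  have htrans := @IsUpperTriangular.mem_support_trans n L hL.isUpperTriangular
  have hne : ∀ {e}, (e, e) ∈ L.support → g ≠ e := fun he e => hg (e ▸ he)
  -- column `d`
  have hcol : ∀ r, (r, r) ∈ L.support → φ (single g d 1) r d = 0 := by
    intro r hr
    obtain ⟨t, hrt, h1, h3⟩ := hL.exists_partner hr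
    have ht := htrans h3 h1
    refine hφ.apply_eq_zero_of_weight_ne (diagonal_mem_lieAlgZero hL.isUpperTriangular h1 h3 hrt)
      (hφ.apply_torus_eq_zero_of_apply_single hL.isUpperTriangular hD h1 h3 hrt) h (hne hd) ?_
    intro he
    simp only [Pi.sub_apply, Pi.single_apply, hne hr, hne ht, hrt, if_true, if_false] at he
    exact one_ne_zero (by linear_combination he : (1 : F) = 0)
  by_cases hs : s = d
  · rw [hs]
    exact hcol r (hrs.resolve_left (not_not.2 hs))
  obtain ⟨d', hdd, h1, h3⟩ := hL.exists_partner hd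
  have hd' := htrans h3 h1
  have hgd' := htrans h h1
  have hA : φ (single g d 1) = ⁅φ (single g d' 1), single d' d (1 : F)⁆ := by
    rw [← single_lie_single d' (hne hd), hφ.leibniz _
      (single_mem_lieAlgZero hL.isUpperTriangular hgd' (hne hd')) _
      (single_mem_lieAlgZero _ h3 hdd.symm), hD d' d hd' hd h3 hdd.symm, lie_zero, add_zero]
  by_cases hr : r = d'
  · subst hr
    by_cases hsr : s = r
    · subst hsr
      refine hφ.apply_eq_zero_of_weight_ne
        (diagonal_mem_lieAlgZero hL.isUpperTriangular h1 h3 hdd)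
        (hφ.apply_torus_eq_zero_of_apply_single hL.isUpperTriangular hD h1 h3 hdd) h (hne hd) ?_
      simp [hne hd, hne hd', hdd]
    · have h4 : φ (single g d 1) r s = - φ (single g r 1) d s := by
        rw [hA, lie_single_apply, if_neg hs, if_pos rfl, zero_sub]
      have h5 := congrFun (congrFun (hφ.leibniz _
        (single_mem_lieAlgZero hL.isUpperTriangular h (hne hd)) _
        (single_mem_lieAlgZero hL.isUpperTriangular hgd' (hne hd'))) g) s
      rw [single_lie_single_of_ne (hne hd).symm (hne hd').symm, map_zero, Matrix.zero_apply,
        Matrix.add_apply, lie_single_apply, single_lie_apply, if_neg hsr, if_pos rfl, if_pos rfl,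
        if_neg hs] at h5
      have h6 : 2 * φ (single g d 1) r s = 0 := by linear_combination h4 + h5
      exact (mul_eq_zero.1 h6).resolve_left h2
  · rw [hA, lie_single_apply, if_neg hs, if_neg hr, sub_zero]

/-- The analogue of `apply_single_col` for rows. -/
theorem apply_single_row (h2 : (2 : F) ≠ 0) (hL : L.IsSDUT)
    (hφ : L.IsDerivationOn hL.isUpperTriangular φ)
    (hD : ∀ p q, (p, p) ∈ L.support → (q, q) ∈ L.support → (p, q) ∈ L.support → p ≠ q →
      φ (single p q 1) = 0)
    {g d : Fin n} (hg : (g, g) ∉ L.support) (hd : (d, d) ∈ L.support) (h : (d, g) ∈ L.support)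
    {r s : Fin n} (hrs : r ≠ d ∨ (s, s) ∈ L.support) : φ (single d g 1) r s = 0 := by
  have htrans := @IsUpperTriangular.mem_support_trans n L hL.isUpperTriangular
  have hne : ∀ {e}, (e, e) ∈ L.support → e ≠ g := fun he e => hg (e ▸ he)
  -- row `d`
  have hrow : ∀ s, (s, s) ∈ L.support → φ (single d g 1) d s = 0 := by
    intro s hs
    obtain ⟨t, hst, h1, h3⟩ := hL.exists_partner hs
    have ht := htrans h3 h1
    refine hφ.apply_eq_zero_of_weight_ne (diagonal_mem_lieAlgZero hL.isUpperTriangular h1 h3 hst)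
      (hφ.apply_torus_eq_zero_of_apply_single hL.isUpperTriangular hD h1 h3 hst) h (hne hd) ?_
    simp [(hne hs).symm, (hne ht).symm, hst]
  by_cases hr : r = d
  · rw [hr]
    exact hrow s (hrs.resolve_left (not_not.2 hr))
  obtain ⟨d', hdd, h1, h3⟩ := hL.exists_partner hd
  have hd' := htrans h3 h1
  have hgd' := htrans h3 h
  have hA : φ (single d g 1) = ⁅single d d' (1 : F), φ (single d' g 1)⁆ := by
    rw [← single_lie_single d' (hne hd), hφ.leibniz _
      (single_mem_lieAlgZero _ h1 hdd) _
      (single_mem_lieAlgZero hL.isUpperTriangular hgd' (hne hd')),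
      hD d d' hd hd' h1 hdd, zero_lie, zero_add]
  by_cases hs : s = d'
  · subst hs
    by_cases hsr : r = s
    · subst hsr
      refine hφ.apply_eq_zero_of_weight_ne
        (diagonal_mem_lieAlgZero hL.isUpperTriangular h1 h3 hdd)
        (hφ.apply_torus_eq_zero_of_apply_single hL.isUpperTriangular hD h1 h3 hdd) h (hne hd) ?_
      simp [(hne hd).symm, (hne hd').symm, hdd]
    · have h4 : φ (single d g 1) r s = - φ (single s g 1) r d := by
        rw [hA, single_lie_apply, if_neg hr, if_pos rfl, zero_sub]
      have h5 := congrFun (congrFun (hφ.leibniz _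
        (single_mem_lieAlgZero hL.isUpperTriangular h (hne hd)) _
        (single_mem_lieAlgZero hL.isUpperTriangular hgd' (hne hd'))) r) g
      rw [single_lie_single_of_ne (hne hd').symm (hne hd).symm, map_zero, Matrix.zero_apply,
        Matrix.add_apply, lie_single_apply, single_lie_apply, if_neg hsr, if_pos rfl, if_pos rfl,
        if_neg hr] at h5
      have h6 : 2 * φ (single d g 1) r s = 0 := by linear_combination h4 - h5
      exact (mul_eq_zero.1 h6).resolve_left h2
  · rw [hA, single_lie_apply, if_neg hs, if_neg hr, sub_zero]

/-- The remaining part of `φ` on the columns of the diagonal blocks is left multiplication by a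
block upper triangular matrix. -/
theorem exists_col_correction (h2 : (2 : F) ≠ 0) (hL : L.IsSDUT)
    (hφ : L.IsDerivationOn hL.isUpperTriangular φ)
    (hD : ∀ p q, (p, p) ∈ L.support → (q, q) ∈ L.support → (p, q) ∈ L.support → p ≠ q →
      φ (single p q 1) = 0) :
    ∃ X : Matrix (Fin n) (Fin n) F, L.IsBlockUpper X ∧
      ∀ p q, (q, q) ∈ L.support → (p, q) ∈ L.support → p ≠ q →
        (φ - LieAlgebra.ad F _ X) (single p q 1) = 0 := by
  have hne : ∀ {e g}, (g, g) ∉ L.support → (e, e) ∈ L.support → g ≠ e := fun hg he e => hg (e ▸ he)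
  -- the coefficients do not depend on the column
  have hindep1 : ∀ r g d e, (g, g) ∉ L.support → (d, d) ∈ L.support → (e, e) ∈ L.support →
      (g, d) ∈ L.support → (d, e) ∈ L.support →
      φ (single g d 1) r d = φ (single g e 1) r e := by
    intro r g d e hg hd he hgd hde
    by_cases hde' : d = e
    · rw [hde']
    have hge := hL.isUpperTriangular.mem_support_trans hgd hde
    by_cases hr : (r, r) ∈ L.support
    · rw [hφ.apply_single_col h2 hL hD hg hd hgd (.inr hr),
        hφ.apply_single_col h2 hL hD hg he hge (.inr hr)]
    rw [← single_lie_single d (hne hg he), hφ.leibniz _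
      (single_mem_lieAlgZero hL.isUpperTriangular hgd (hne hg hd)) _
      (single_mem_lieAlgZero _ hde hde'), hD d e hd he hde hde', lie_zero, add_zero,
      lie_single_apply, if_pos rfl, if_neg (hne hr hd), sub_zero]
  have hindep : ∀ r g d e, (g, g) ∉ L.support → (d, d) ∈ L.support → (e, e) ∈ L.support →
      (g, d) ∈ L.support → (g, e) ∈ L.support →
      φ (single g d 1) r d = φ (single g e 1) r e := by
    intro r g d e hg hd he hgd hge
    rcases mem_support_or_swap hd he with h | h
    · exact hindep1 r g d e hg hd he hgd h
    · exact (hindep1 r g e d hg he hd hge h).symm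
  have hex : ∀ r g, ∃ x : F, (x ≠ 0 → (r, r) ∉ L.support ∧ (g, g) ∉ L.support ∧
      L.block r ≤ L.block g) ∧ ((g, g) ∉ L.support → ∀ d, (d, d) ∈ L.support →
        (g, d) ∈ L.support → φ (single g d 1) r d = x) := by
    intro r g
    by_cases hg : (g, g) ∉ L.support ∧ ∃ d, (d, d) ∈ L.support ∧ (g, d) ∈ L.support
    · obtain ⟨hg, d, hd, hgd⟩ := hg
      refine ⟨φ (single g d 1) r d, fun h0 => ?_, fun _ e he hge =>
        hindep r g e d hg he hd hge hgd⟩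
      have hr : (r, r) ∉ L.support := fun hr =>
        h0 (hφ.apply_single_col h2 hL hD hg hd hgd (.inr hr))
      refine ⟨hr, hg, hL.block_le_of_rows hr fun e he hge => ?_⟩
      rw [hindep r g d e hg hd he hgd hge] at h0
      exact hφ.mem_support (single_mem_lieAlgZero _ hge (hne hg he)) h0
    · exact ⟨0, fun h => absurd rfl h, fun h1 d hd hgd => absurd ⟨h1, d, hd, hgd⟩ hg⟩
  choose X hX1 hX2 using hex
  refine ⟨of X, fun r g hrg => ?_, fun p q hq h hpq => ?_⟩
  · by_contra h0
    exact absurd (hX1 r g h0).2.2 (not_le.2 hrg)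
  · rw [LinearMap.sub_apply, LieAlgebra.ad_apply, sub_eq_zero]
    ext r s
    have hqs : X q s = 0 := by_contra fun h0 => (hX1 q s h0).1 hq
    rw [lie_single_apply, of_apply, of_apply, hqs, ite_self, sub_zero]
    by_cases hp : (p, p) ∈ L.support
    · have hrp : X r p = 0 := by_contra fun h0 => (hX1 r p h0).2.1 hp
      rw [hD p q hp hq h hpq, hrp, ite_self, Matrix.zero_apply]
    · by_cases hs : s = q
      · rw [hs, if_pos rfl, hX2 r p hp q hq h]
      · rw [if_neg hs, hφ.apply_single_col h2 hL hD hp hq h (.inl hs)]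

/-- The remaining part of `φ` on the rows of the diagonal blocks is right multiplication by a
block upper triangular matrix, which can be chosen so as to annihilate the columns of the diagonal
blocks: if `(g, e)` belongs to the support for some `e` on a diagonal block, then `φ` kills `E_ge`
and `[E_dh, E_ge]`, which is `E_de` or zero, so `φ(E_dh)` has no entry at `(d, g)`. -/
theorem exists_row_correction (h2 : (2 : F) ≠ 0) (hL : L.IsSDUT)
    (hφ : L.IsDerivationOn hL.isUpperTriangular φ)
    (hC : ∀ p q, (q, q) ∈ L.support → (p, q) ∈ L.support → p ≠ q → φ (single p q 1) = 0) :
    ∃ X : Matrix (Fin n) (Fin n) F, L.IsBlockUpper X ∧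
      (∀ p q, (q, q) ∈ L.support → (p, q) ∈ L.support → p ≠ q →
        (φ - LieAlgebra.ad F _ X) (single p q 1) = 0) ∧
      ∀ p q, (p, p) ∈ L.support → (p, q) ∈ L.support → p ≠ q →
        (φ - LieAlgebra.ad F _ X) (single p q 1) = 0 := by
  have htrans := @IsUpperTriangular.mem_support_trans n L hL.isUpperTriangular
  have hD : ∀ p q, (p, p) ∈ L.support → (q, q) ∈ L.support → (p, q) ∈ L.support → p ≠ q →
      φ (single p q 1) = 0 := fun p q _ => hC p q
  have hne : ∀ {e g}, (g, g) ∉ L.support → (e, e) ∈ L.support → e ≠ g := fun hg he e => hg (e ▸ he)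
  -- the coefficients do not depend on the row
  have hindep1 : ∀ r g d e, (g, g) ∉ L.support → (d, d) ∈ L.support → (e, e) ∈ L.support →
      (e, g) ∈ L.support → (d, e) ∈ L.support →
      φ (single d g 1) d r = φ (single e g 1) e r := by
    intro r g d e hg hd he hge hde
    by_cases hde' : d = e
    · rw [hde']
    have hgd := htrans hde hge
    by_cases hr : (r, r) ∈ L.support
    · rw [hφ.apply_single_row h2 hL hD hg hd hgd (.inr hr),
        hφ.apply_single_row h2 hL hD hg he hge (.inr hr)]
    rw [← single_lie_single e (hne hg hd), hφ.leibniz _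
      (single_mem_lieAlgZero _ hde hde') _
      (single_mem_lieAlgZero hL.isUpperTriangular hge (hne hg he)), hD d e hd he hde hde',
      zero_lie, zero_add, single_lie_apply, if_pos rfl, if_neg (hne hr he).symm, sub_zero]
  have hindep : ∀ r g d e, (g, g) ∉ L.support → (d, d) ∈ L.support → (e, e) ∈ L.support →
      (d, g) ∈ L.support → (e, g) ∈ L.support →
      φ (single d g 1) d r = φ (single e g 1) e r := by
    intro r g d e hg hd he hgd hge
    rcases mem_support_or_swap hd he with h | h
    · exact hindep1 r g d e hg hd he hge h
    · exact (hindep1 r g e d hg he hd hgd h).symm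
  have hex : ∀ g r, ∃ x : F, (x ≠ 0 → (r, r) ∉ L.support ∧ (g, g) ∉ L.support ∧
      L.block g ≤ L.block r ∧ ∀ e, (e, e) ∈ L.support → (r, e) ∉ L.support) ∧
      ((g, g) ∉ L.support → ∀ d, (d, d) ∈ L.support → (d, g) ∈ L.support →
        φ (single d g 1) d r = -x) := by
    intro g r
    by_cases hg : (g, g) ∉ L.support ∧ ∃ d, (d, d) ∈ L.support ∧ (d, g) ∈ L.support
    · obtain ⟨hg, d, hd, hgd⟩ := hg
      refine ⟨-φ (single d g 1) d r, fun h0 => ?_, fun _ e he hge => by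
        rw [neg_neg, hindep r g e d hg he hd hge hgd]⟩
      replace h0 := neg_ne_zero.1 h0
      have hr : (r, r) ∉ L.support := fun hr =>
        h0 (hφ.apply_single_row h2 hL hD hg hd hgd (.inr hr))
      have hdr := hφ.mem_support (single_mem_lieAlgZero _ hgd (hne hg hd)) h0
      refine ⟨hr, hg, hL.block_le_of_cols hr fun e he hge => ?_, fun e he hre => h0 ?_⟩
      · rw [hindep r g d e hg hd he hgd hge] at h0
        exact hφ.mem_support (single_mem_lieAlgZero _ hge (hne hg he)) h0
      · have hde : d ≠ e := fun hde => hr (htrans hre (hde ▸ hdr))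
        have h5 := hφ.leibniz _ (single_mem_lieAlgZero hL.isUpperTriangular hgd (hne hg hd)) _
          (single_mem_lieAlgZero hL.isUpperTriangular hre (hne hr he).symm)
        have h6 : φ ⁅single d g (1 : F), single r e 1⁆ = 0 := by
          by_cases hgr : g = r
          · subst hgr
            rw [single_lie_single _ hde, hC d e he (htrans hdr hre) hde]
          · rw [single_lie_single_of_ne hgr hde.symm, map_zero]
        rw [h6, hC r e he hre (hne hr he).symm, lie_zero, add_zero] at h5
        have h7 := congrFun (congrFun h5 d) e
        rw [lie_single_apply, if_pos rfl, if_neg (hne hr hd), sub_zero] at h7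
        exact h7.symm
    · exact ⟨0, fun h => absurd rfl h, fun h1 d hd hgd => absurd ⟨h1, d, hd, hgd⟩ hg⟩
  choose X hX1 hX2 using hex
  have hcol : ∀ p q, (q, q) ∈ L.support → (p, q) ∈ L.support → p ≠ q →
      (φ - LieAlgebra.ad F _ (of X)) (single p q 1) = 0 := by
    intro p q hq h hpq
    rw [LinearMap.sub_apply, LieAlgebra.ad_apply, hC p q hq h hpq, zero_sub, neg_eq_zero]
    ext r s
    have hqs : X q s = 0 := by_contra fun h0 => (hX1 q s h0).2.1 hq
    have hrp : X r p = 0 := by_contra fun h0 => (hX1 r p h0).2.2.2 q hq h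
    rw [lie_single_apply, of_apply, of_apply, hqs, hrp, ite_self, ite_self, sub_zero,
      Matrix.zero_apply]
  refine ⟨of X, fun g r hrg => ?_, hcol, fun p q hp h hpq => ?_⟩
  · by_contra h0
    exact absurd (hX1 g r h0).2.2.1 (not_le.2 hrg)
  · by_cases hq : (q, q) ∈ L.support
    · exact hcol p q hq h hpq
    rw [LinearMap.sub_apply, LieAlgebra.ad_apply, sub_eq_zero]
    ext r s
    have hrp : X r p = 0 := by_contra fun h0 => (hX1 r p h0).1 hp
    rw [lie_single_apply, of_apply, of_apply, hrp, ite_self, zero_sub]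
    by_cases hr : r = p
    · rw [hr, if_pos rfl, hX2 q s hq p hp h]
    · rw [if_neg hr, neg_zero, hφ.apply_single_row h2 hL hD hq hp h (.inl hr)]

/-- A derivation of `M_L^0` is the commutator with a block upper triangular matrix. -/
theorem exists_isBlockUpper (h2 : (2 : F) ≠ 0) (h3 : (3 : F) ≠ 0) (hL : L.IsSDUT)
    (hφ : L.IsDerivationOn hL.isUpperTriangular φ) :
    ∃ X : Matrix (Fin n) (Fin n) F, L.IsBlockUpper X ∧
      ∀ B ∈ L.lieAlgZero F hL.isUpperTriangular, φ B = ⁅X, B⁆ := by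
  have htrans := @IsUpperTriangular.mem_support_trans n L hL.isUpperTriangular
  obtain ⟨X₁, hX₁, htor⟩ := hφ.exists_torus_correction h2 hL
  have hφ₁ := hφ.sub_ad hX₁
  have heig : ∀ p q, (p, q) ∈ L.support → (q, p) ∈ L.support → p ≠ q → _ := fun p q h h' hpq =>
    eq_smul_single fun r s hrs => hφ₁.apply_single_of_mem_block h2 h3 hL htor h h' hpq hrs
  have hzero := fun p q h h' hpq => hφ₁.apply_torus_eq_zero h2 hL.isUpperTriangular h h' hpq
    (heig p q h h' hpq) (heig q p h' h (Ne.symm hpq))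
  obtain ⟨x, hx⟩ := hφ₁.exists_diagonal_correction hL
    (fun p q hp hq h hpq => by
      by_cases h' : (q, p) ∈ L.support
      · exact heig p q h h' hpq
      · exact eq_smul_single fun r s hrs => hφ₁.apply_single_of_not_mem_block h2 h3 hL
          (fun u v huv hvu hne => (hzero u v huv hvu hne).2) hp hq h h' hrs)
    fun p q h h' hpq => (hzero p q h h' hpq).1
  have hX₂ : L.IsBlockUpper (diagonal x) := blockTriangular_diagonal x
  have hφ₂ := hφ₁.sub_ad hX₂
  obtain ⟨X₃, hX₃, hcol⟩ := hφ₂.exists_col_correction h2 hL hx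
  have hφ₃ := hφ₂.sub_ad hX₃
  obtain ⟨X₄, hX₄, hcol', hrow'⟩ := hφ₃.exists_row_correction h2 hL hcol
  have hφ₄ := hφ₃.sub_ad hX₄
  refine ⟨X₁ + diagonal x + X₃ + X₄, ((hX₁.add hX₂).add hX₃).add hX₄, fun B hB => ?_⟩
  suffices h0 : (φ - LieAlgebra.ad F _ X₁ - LieAlgebra.ad F _ (diagonal x) -
      LieAlgebra.ad F _ X₃ - LieAlgebra.ad F _ X₄) B = 0 by
    simp only [LinearMap.sub_apply, LieAlgebra.ad_apply] at h0
    simp only [add_lie]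
    rw [← sub_eq_zero, ← h0]
    abel
  rw [← LinearMap.mem_ker]
  refine lieAlgZero_le_of_single_mem hL.isUpperTriangular (fun p q h hpq => ?_)
    (fun p q h h' hpq => ?_) hB
  · obtain ⟨d, hd, h1, h4⟩ := hL.exists_between h
    by_cases hp : p = d
    · exact hrow' p q (hp ▸ hd) h hpq
    by_cases hq : d = q
    · exact hcol' p q (hq ▸ hd) h hpq
    rw [LinearMap.mem_ker, ← single_lie_single d hpq, hφ₄.leibniz _
      (single_mem_lieAlgZero _ h1 hp) _ (single_mem_lieAlgZero _ h4 hq), hcol' p d hd h1 hp,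
      hrow' d q hd h4 hq, zero_lie, lie_zero, add_zero]
  · exact hφ₄.apply_torus_eq_zero_of_apply_single hL.isUpperTriangular
      (fun p q _ => hcol' p q) h h' hpq

end IsDerivationOn

end Ladder

/-! ### The derivation algebra -/

namespace Ladder

open Matrix

variable {F : Type*} [Field F] {n : ℕ} {L : Ladder n}

theorem IsSDUT.exists_isBlockUpper (h2 : (2 : F) ≠ 0) (h3 : (3 : F) ≠ 0) (hL : L.IsSDUT)
    (f : LieDerivation F (L.lieAlgZero F hL.isUpperTriangular)
      (L.lieAlgZero F hL.isUpperTriangular)) :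
    ∃ X : Matrix (Fin n) (Fin n) F, L.IsBlockUpper X ∧
      ∀ B : L.lieAlgZero F hL.isUpperTriangular,
        (f B : Matrix (Fin n) (Fin n) F) = ⁅X, (B : Matrix (Fin n) (Fin n) F)⁆ := by
  obtain ⟨φ, hφ⟩ := LinearMap.exists_extend
    (p := (L.lieAlgZero F hL.isUpperTriangular).toSubmodule)
    ((L.lieAlgZero F hL.isUpperTriangular).toSubmodule.subtype ∘ₗ f.toLinearMap)
  have hφ' : ∀ B : L.lieAlgZero F hL.isUpperTriangular, φ B = f B :=
    fun B => LinearMap.congr_fun hφ B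
  have hder : L.IsDerivationOn hL.isUpperTriangular φ :=
    { mem := fun A hA => by
        rw [hφ' ⟨A, hA⟩]
        exact (f ⟨A, hA⟩).2.1
      leibniz := fun A hA B hB => by
        have h := hφ' ⁅(⟨A, hA⟩ : L.lieAlgZero F hL.isUpperTriangular), ⟨B, hB⟩⁆
        rw [LieDerivation.apply_lie_eq_add] at h
        rw [hφ' ⟨A, hA⟩, hφ' ⟨B, hB⟩, add_comm]
        exact h }
  obtain ⟨X, hX, h⟩ := hder.exists_isBlockUpper h2 h3 hL
  exact ⟨X, hX, fun B => by rw [← hφ' B, h B B.2]⟩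

/-- The commutator with an element of the normalizer of `M_L` preserves `M_L^0 = [M_L, M_L]`. -/
theorem IsSDUT.lie_mem_lieAlgZero (hL : L.IsSDUT) {X B : Matrix (Fin n) (Fin n) F}
    (hX : X ∈ (L.lieAlg F hL.isUpperTriangular).normalizer)
    (hB : B ∈ L.lieAlgZero F hL.isUpperTriangular) :
    ⁅X, B⁆ ∈ L.lieAlgZero F hL.isUpperTriangular := by
  rw [LieSubalgebra.mem_normalizer_iff] at hX
  have hmem := (hL.mem_derived_iff ⟨B, hB.1⟩).2 hB
  rw [← LieSubmodule.mem_toSubmodule, LieSubmodule.lieIdeal_oper_eq_linear_span'] at hmem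
  have hle : Submodule.span F {x | ∃ y ∈ (⊤ : LieIdeal F (L.lieAlg F hL.isUpperTriangular)),
      ∃ z ∈ (⊤ : LieIdeal F (L.lieAlg F hL.isUpperTriangular)), ⁅y, z⁆ = x} ≤
      (L.lieAlgZero F hL.isUpperTriangular).toSubmodule.comap
        ((LieAlgebra.ad F (Matrix (Fin n) (Fin n) F) X).comp
          (L.lieAlg F hL.isUpperTriangular).toSubmodule.subtype) := by
    rw [Submodule.span_le]
    rintro _ ⟨y, -, z, -, rfl⟩
    have key : ∀ y z : Matrix (Fin n) (Fin n) F, y ∈ L.lieAlg F hL.isUpperTriangular →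
        z ∈ L.lieAlg F hL.isUpperTriangular → ⁅y, z⁆ ∈ L.lieAlgZero F hL.isUpperTriangular :=
      fun y z hy hz => ⟨(L.lieAlg F hL.isUpperTriangular).lie_mem hy hz, fun k =>
        hL.isUpperTriangular.blockTrace_lie k hy hz⟩
    change ⁅X, ⁅(y : Matrix (Fin n) (Fin n) F), (z : Matrix (Fin n) (Fin n) F)⁆⁆ ∈
      L.lieAlgZero F hL.isUpperTriangular
    rw [leibniz_lie]
    exact add_mem (key _ _ (hX y y.2) z.2) (key _ _ y.2 (hX z z.2))
  exact hle hmem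

/-- The derivation `B ↦ [X, B]` of a Lie subalgebra `H` that is preserved by `X`. -/
def adRestrict {G : Type*} [LieRing G] [LieAlgebra F G] (H : LieSubalgebra F G) (X : G)
    (hX : ∀ B ∈ H, ⁅X, B⁆ ∈ H) : LieDerivation F H H where
  toFun B := ⟨⁅X, (B : G)⁆, hX B B.2⟩
  map_add' A B := Subtype.ext (lie_add X (A : G) (B : G))
  map_smul' c B := Subtype.ext (lie_smul c X (B : G))
  leibniz' A B := Subtype.ext <| by
    change ⁅X, ⁅(A : G), (B : G)⁆⁆ = ⁅(A : G), ⁅X, (B : G)⁆⁆ - ⁅(B : G), ⁅X, (A : G)⁆⁆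
    rw [leibniz_lie, ← lie_skew (B : G), sub_neg_eq_add, add_comm]

theorem coe_adRestrict_apply {G : Type*} [LieRing G] [LieAlgebra F G] (H : LieSubalgebra F G)
    (X : G) (hX : ∀ B ∈ H, ⁅X, B⁆ ∈ H) (B : H) : (adRestrict H X hX B : G) = ⁅X, (B : G)⁆ := rfl

/-- The homomorphism `X ↦ (ad X)|_{M_L^0}` from the normalizer of `M_L` to the derivation algebra of
`M_L^0`. -/
def IsSDUT.adZero (hL : L.IsSDUT) : (L.lieAlg F hL.isUpperTriangular).normalizer →ₗ⁅F⁆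
    LieDerivation F (L.lieAlgZero F hL.isUpperTriangular)
      (L.lieAlgZero F hL.isUpperTriangular) where
  toFun X := adRestrict (L.lieAlgZero F hL.isUpperTriangular) X
    fun _ hB => hL.lie_mem_lieAlgZero X.2 hB
  map_add' X Y := LieDerivation.ext fun B => Subtype.ext <| by
    simp only [LieDerivation.add_apply, AddMemClass.coe_add, coe_adRestrict_apply, add_lie]
  map_smul' c X := LieDerivation.ext fun B => Subtype.ext <| by
    simp only [LieDerivation.smul_apply, SetLike.val_smul, coe_adRestrict_apply, smul_lie,
      RingHom.id_apply]
  map_lie' {X Y} := LieDerivation.ext fun B => Subtype.ext <| by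
    simp only [LieDerivation.lie_apply, AddSubgroupClass.coe_sub, LieSubalgebra.coe_bracket,
      coe_adRestrict_apply, lie_lie]

theorem IsSDUT.coe_adZero_apply (hL : L.IsSDUT)
    (X : (L.lieAlg F hL.isUpperTriangular).normalizer)
    (B : L.lieAlgZero F hL.isUpperTriangular) :
    (hL.adZero (F := F) X B : Matrix (Fin n) (Fin n) F) =
      ⁅(X : Matrix (Fin n) (Fin n) F), (B : Matrix (Fin n) (Fin n) F)⁆ := rfl

theorem IsSDUT.ker_adZero (hL : L.IsSDUT) :
    (hL.adZero (F := F)).ker = centralizerIdeal (L.lieAlg F hL.isUpperTriangular) := by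
  ext X
  rw [LieHom.mem_ker]
  constructor
  · intro h
    refine hL.mem_lieCentralizer fun B hB => ?_
    rw [← hL.coe_adZero_apply X ⟨B, hB⟩, h]
    rfl
  · intro h
    exact LieDerivation.ext fun B => Subtype.ext <| by
      rw [hL.coe_adZero_apply, h B B.2.1]
      rfl

theorem IsSDUT.adZero_surjective (h2 : (2 : F) ≠ 0) (h3 : (3 : F) ≠ 0) (hL : L.IsSDUT) :
    Function.Surjective (hL.adZero (F := F)) := by
  intro f
  obtain ⟨X, hX, h⟩ := hL.exists_isBlockUpper h2 h3 f
  exact ⟨⟨X, hX.mem_normalizer hL.isUpperTriangular⟩,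
    LieDerivation.ext fun B => Subtype.ext <| by rw [hL.coe_adZero_apply, h B]⟩

end Ladder

/-- The first isomorphism theorem for a surjective homomorphism of Lie algebras. -/
theorem LieHom.exists_quotient_equiv {R G G' : Type*} [CommRing R] [LieRing G] [LieAlgebra R G]
    [LieRing G'] [LieAlgebra R G'] (f : G →ₗ⁅R⁆ G') (hf : Function.Surjective f)
    {I : LieIdeal R G} (hI : f.ker = I) :
    ∃ Φ : (G ⧸ I) ≃ₗ⁅R⁆ G', ∀ x, Φ (LieSubmodule.Quotient.mk x) = f x := by
  subst hI
  have hr : f.range = ⊤ := (LieHom.range_eq_top f).2 hf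
  exact ⟨f.quotKerEquivRange.trans ((LieEquiv.ofEq _ _ (by rw [hr])).trans LieSubalgebra.topEquiv),
    fun x => rfl⟩
theorem mainTheorem2 {F : Type*} [Field F] (h2 : ringChar F ≠ 2) (h3 : ringChar F ≠ 3)
    {n : ℕ} (L : Ladder n) (hL : L.IsSDUT) :
    -- `M_L^0 = [M_L, M_L]`
    (∀ A : L.lieAlg F hL.isUpperTriangular,
      A ∈ ⁅(⊤ : LieIdeal F (L.lieAlg F hL.isUpperTriangular)),
          (⊤ : LieIdeal F (L.lieAlg F hL.isUpperTriangular))⁆ ↔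
        (A : Matrix (Fin n) (Fin n) F) ∈ L.lieAlgZero F hL.isUpperTriangular) ∧
    -- every derivation of `M_L^0` extends to a derivation of `M_L`
    (∀ f : LieDerivation F (L.lieAlgZero F hL.isUpperTriangular)
        (L.lieAlgZero F hL.isUpperTriangular),
      ∃ g : LieDerivation F (L.lieAlg F hL.isUpperTriangular) (L.lieAlg F hL.isUpperTriangular),
        ∀ B : L.lieAlgZero F hL.isUpperTriangular,
          g ⟨B, L.lieAlgZero_le F hL.isUpperTriangular B.2⟩ =
            ⟨f B, L.lieAlgZero_le F hL.isUpperTriangular (f B).2⟩) ∧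
    -- every derivation of `M_L^0` is `ad X` for a block upper triangular matrix `X`
    (∀ f : LieDerivation F (L.lieAlgZero F hL.isUpperTriangular)
        (L.lieAlgZero F hL.isUpperTriangular),
      ∃ X : Matrix (Fin n) (Fin n) F, L.IsBlockUpper X ∧
        ∀ B : L.lieAlgZero F hL.isUpperTriangular,
          (f B : Matrix (Fin n) (Fin n) F) = ⁅X, (B : Matrix (Fin n) (Fin n) F)⁆) ∧
    -- `X ↦ ad X` identifies `N(M_L) / C(M_L)` with the derivation algebra of `M_L^0`
    (∃ Φ : ((L.lieAlg F hL.isUpperTriangular).normalizer ⧸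
          centralizerIdeal (L.lieAlg F hL.isUpperTriangular)) ≃ₗ⁅F⁆
        LieDerivation F (L.lieAlgZero F hL.isUpperTriangular)
          (L.lieAlgZero F hL.isUpperTriangular),
      ∀ (X : (L.lieAlg F hL.isUpperTriangular).normalizer)
        (B : L.lieAlgZero F hL.isUpperTriangular),
        (Φ (LieSubmodule.Quotient.mk X) B : Matrix (Fin n) (Fin n) F) =
          ⁅(X : Matrix (Fin n) (Fin n) F), (B : Matrix (Fin n) (Fin n) F)⁆) := by
  have h2' : (2 : F) ≠ 0 := Ring.two_ne_zero h2
  have h3' : (3 : F) ≠ 0 := fun h => by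
    have hdvd : ringChar F ∣ 3 := ringChar.dvd (by exact_mod_cast h)
    rcases (Nat.dvd_prime Nat.prime_three).1 hdvd with h | h
    · exact CharP.ringChar_ne_one h
    · exact h3 h
  refine ⟨hL.mem_derived_iff, fun f => ?_, hL.exists_isBlockUpper h2' h3', ?_⟩
  · obtain ⟨X, hX, h⟩ := hL.exists_isBlockUpper h2' h3' f
    exact ⟨Ladder.adRestrict (L.lieAlg F hL.isUpperTriangular) X
      fun _ hB => hX.lie_mem hL.isUpperTriangular hB, fun B => Subtype.ext (h B).symm⟩
  · obtain ⟨Φ, hΦ⟩ := LieHom.exists_quotient_equiv hL.adZero (hL.adZero_surjective h2' h3')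
      hL.ker_adZero
    exact ⟨Φ, fun X B => by rw [hΦ, hL.coe_adZero_apply]⟩
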